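/- Let $R$ be one of the rings $\mathbb{Z},\mathbb{Q},\mathbb{R},\mathbb{C}$ with its usual absolute value, and let $M_2$ be the free monoid of all finite words (including the empty word $\epsilon$) over the alphabet $\{a_1,a_2\}$. For a non-empty word $v\in M_2$ let $\rho_v\colon M_2\to R$ be the function that sends $w$ to the number of (possibly overlapping) occurrences of $v$ as a contiguous subword of $w$, and let $\rho_\epsilon(w)=|w|$ be the length of $w$. A counting function is a finite $R$-linear combination of the functions $\rho_v$, $v\in M_2$, and $\widehat{C}$ denotes the $R$-module of counting functions modulo those counting functions that are bounded on $M_2$. For integers $k,m\ge 1$ and a word $v$ put $$\sigma_k^m(v)=\sum_{i=0}^{k-1}\sum_{j=0}^{m-1}\rho_{a_2a_1^iva_1^ja_2}.$$ Define the following subsets of $\widehat{C}$, functions standing for their classes: $$B_U'=\{\rho_{a_1^k} : k\ge 0\},\qquad B_V'=\{\sigma_k^m(v) : k,m\ge 1,\ v\in M_2\setminus\{\epsilon\}\text{ with first letter and last letter both equal to }a_2\}.$$ Then the set $B'=B_V'\cup B_U'$ is a basis of the $R$-module $\widehat{C}$. -/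

import Mathlib

namespace CountingFn

/-- The free monoid `M_r`: all finite words, including the empty one, over an alphabet of
`r` letters. -/
abbrev Word (r : ℕ) : Type := List (Fin r)

/-- The number of (possibly overlapping) occurrences of `v` in `w`, counted by their starting
positions `i < |w|`. For the empty word this is `|w|`, see `occ_nil`. -/
def occ {r : ℕ} (v w : Word r) : ℕ :=
  ((Finset.range w.length).filter fun i => v <+: w.drop i).card

theorem occ_nil {r : ℕ} (w : Word r) : occ [] w = w.length := by
  simp [occ]

variable (R : Type) [NormedCommRing R]

/-- The elementary counting function `ρ_v`, with values in the coefficient ring. -/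
def rho {r : ℕ} (v : Word r) : Word r → R := fun w => (occ v w : R)

/-- The module of counting functions on `M_r`: all (finite) linear combinations of elementary
counting functions. -/
def Counting (r : ℕ) : Submodule R (Word r → R) :=
  Submodule.span R (Set.range fun v : Word r => rho R v)

/-- The module of bounded functions on `M_r`. -/
def Bounded (r : ℕ) : Submodule R (Word r → R) where
  carrier := {f | ∃ K : ℝ, ∀ w, ‖f w‖ ≤ K}
  zero_mem' := ⟨0, fun w => by simp⟩
  add_mem' := by
    rintro f g ⟨K, hK⟩ ⟨L, hL⟩
    exact ⟨K + L, fun w => (norm_add_le _ _).trans (add_le_add (hK w) (hL w))⟩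
  smul_mem' := by
    rintro c f ⟨K, hK⟩
    exact ⟨‖c‖ * K, fun w =>
      (norm_mul_le _ _).trans (mul_le_mul_of_nonneg_left (hK w) (norm_nonneg c))⟩

/-- The space of counting functions on `M_r` modulo bounded functions. -/
abbrev CHat (r : ℕ) : Type :=
  (Counting R r) ⧸ (Bounded R r).submoduleOf (Counting R r)

/-- The class of `ρ_v` modulo bounded functions. -/
def rhoClass {r : ℕ} (v : Word r) : CHat R r :=
  Submodule.Quotient.mk ⟨rho R v, Submodule.subset_span ⟨v, rfl⟩⟩

/-- The first letter of the alphabet of `M_2`. -/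
abbrev a₁ : Fin 2 := 0

/-- The second letter of the alphabet of `M_2`. -/
abbrev a₂ : Fin 2 := 1

/-- The class of `σ_k^m(v) = ∑_{0 ≤ i < k, 0 ≤ j < m} ρ_{a₂ a₁^i v a₁^j a₂}`. -/
def sigmaClass (k m : ℕ) (v : Word 2) : CHat R 2 :=
  ∑ i ∈ Finset.range k, ∑ j ∈ Finset.range m,
    rhoClass R ([a₂] ++ List.replicate i a₁ ++ v ++ List.replicate j a₁ ++ [a₂])

/-- `B_U'`: the classes of `ρ_{a₁^k}`, `k ≥ 0`. -/
def BU' : Set (CHat R 2) :=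
  {x | ∃ k : ℕ, x = rhoClass R (List.replicate k a₁)}

/-- `B_V'`: the classes of `σ_k^m(v)` for `k, m ≥ 1` and `v` a word whose first letter and last
letter are both `a₂`. (For `k = 0` or `m = 0` the empty sum `σ_k^m(v)` is `0`.) -/
def BV' : Set (CHat R 2) :=
  {x | ∃ (k m : ℕ) (v : Word 2), 1 ≤ k ∧ 1 ≤ m ∧ v.head? = some a₂ ∧ v.getLast? = some a₂ ∧
    x = sigmaClass R k m v}

/-- `B' = B_V' ∪ B_U'`. -/
def B' : Set (CHat R 2) := BV' R ∪ BU' R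

/-- The set `S` is a basis of the `R`-module of counting functions modulo bounded functions:
there is a basis indexed by `S` itself whose vector at `x ∈ S` is `x`. -/
def IsBasis (S : Set (CHat R 2)) : Prop :=
  ∃ b : Module.Basis S R (CHat R 2), ∀ x : S, b x = (x : CHat R 2)

end CountingFn

namespace CountingFn

/-! ### Counting occurrences: extension relations and additivity over padded concatenation. -/

section Occ

variable {r : ℕ}

/-! Modulo bounded functions, `ρ_u` is the sum of `ρ` over the one-letter left extensions of `u`,
and likewise on the right. Solving these relations for the extension by `a₁` removes outer letters
`a₁`, so the empty word and the capped words (first and last letter `a₂`) span.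

They are independent: a capped word cannot end or start inside a block of `a₁`, so its count on `(w
a₁^N)^n`, for `N` large, is exactly `n` times its count on `w`. A bounded combination therefore
vanishes exactly on every `w`. Comparing two values of `N` kills the coefficient of the empty word,
and evaluating on the capped words by increasing length kills the rest
(`linearIndependent_rhoClass_word`).

`B'` is triangular over this basis with diagonal entries `±1`: the top term of `σ_k^m(v)` is `a₂
a₁^(k-1) v a₁^(m-1) a₂`, and that of `ρ_{a₁^k}` is `a₂ a₁^(k-2) a₂` for `k ≥ 2`
(`blockFamily_triangular`). -/

theorem occ_nil_right (u : Word r) : occ u [] = 0 := by simp [occ]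

theorem occ_cons_right (u : Word r) (x : Fin r) (w : Word r) :
    occ u (x :: w) = (if u <+: x :: w then 1 else 0) + occ u w := by
  unfold occ
  rw [List.length_cons, Finset.card_filter, Finset.card_filter, Finset.sum_range_succ', add_comm]
  simp

/-- Left extension: the occurrences of `u` and those of its one-letter left extensions differ
at most by an occurrence at the beginning. -/
theorem occ_left_extension (u w : Word 2) :
    occ u w + (if u = [] then 1 else 0) =
      occ (0 :: u) w + occ (1 :: u) w + (if u <+: w then 1 else 0) := by
  induction w with
  | nil => simp [occ_nil_right]
  | cons x w ih =>
    simp only [occ_cons_right]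
    have h : (if (0 :: u) <+: x :: w then 1 else 0) + (if (1 :: u) <+: x :: w then 1 else 0) =
        (if u <+: w then 1 else 0) := by
      fin_cases x <;> simp [List.cons_prefix_cons]
    omega

theorem concat_prefix_iff_zero_or_one (u w : Word 2) :
    (if u ++ [0] <+: w then 1 else 0) + (if u ++ [1] <+: w then 1 else 0) +
      (if u = w then 1 else 0) = (if u <+: w then 1 else 0) := by
  induction u generalizing w with
  | nil =>
    cases w with
    | nil => simp
    | cons x w => fin_cases x <;> simp [List.cons_prefix_cons]
  | cons y u ih =>
    cases w with
    | nil => simp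
    | cons x w =>
      by_cases h : y = x
      · simpa [List.cons_prefix_cons, h] using ih w
      · simp [List.cons_prefix_cons, h]

/-- Right extension: the occurrences of `u` and those of its one-letter right extensions differ
at most by an occurrence at the end. -/
theorem occ_right_extension (u w : Word 2) :
    occ u w + (if u = [] then 1 else 0) =
      occ (u ++ [0]) w + occ (u ++ [1]) w + (if u <:+ w then 1 else 0) := by
  induction w with
  | nil => simp [occ_nil_right]
  | cons x w ih =>
    simp only [occ_cons_right]
    have h := concat_prefix_iff_zero_or_one u (x :: w)
    -- Prepending a letter creates one new suffix, the whole word; this is the occurrence at the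
    -- front that no letter follows.
    have h' : (if u <:+ x :: w then 1 else 0) =
        (if u = x :: w then 1 else 0) + (if u <:+ w then 1 else 0) := by
      simp only [List.suffix_cons_iff]
      by_cases h1 : u = x :: w
      · subst h1
        have : ¬ (x :: w <:+ w) := fun h => by simpa using h.length_le
        simp [this]
      · simp [h1]
    omega

/-- Words that start and end with the letter `a₂`. -/
def IsCapped (v : Word 2) : Prop := v.head? = some a₂ ∧ v.getLast? = some a₂

/-- The block is too long for `v` to cross it, and `v` cannot end inside it because its last letter
is `a₂`. -/
theorem IsCapped.prefix_append_replicate {v w y : Word 2} (hv : IsCapped v) {N : ℕ}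
    (hN : v.length ≤ N) (h : v <+: w ++ (List.replicate N a₁ ++ y)) : v <+: w := by
  rw [← List.append_assoc] at h
  have h1 : v <+: w ++ List.replicate N a₁ :=
    List.prefix_of_prefix_length_le h (List.prefix_append _ _) (by simp; omega)
  rcases le_total v.length w.length with hl | hl
  · exact List.prefix_of_prefix_length_le h1 (List.prefix_append _ _) hl
  · obtain ⟨t, rfl⟩ := List.prefix_of_prefix_length_le (List.prefix_append _ _) h1 hl
    rw [List.prefix_append_right_inj] at h1
    have ht : t = List.replicate t.length a₁ := by
      refine List.eq_replicate_iff.2 ⟨rfl, fun b hb => ?_⟩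
      exact List.eq_of_mem_replicate (h1.subset hb)
    rcases t.eq_nil_or_concat' with rfl | ⟨s, x, rfl⟩
    · simp
    · have hx : x = a₁ := List.eq_of_mem_replicate (h1.subset (by simp))
      have := hv.2
      simp [hx] at this

theorem IsCapped.occ_replicate_append {v : Word 2} (hv : IsCapped v) (N : ℕ) (y : Word 2) :
    occ v (List.replicate N a₁ ++ y) = occ v y := by
  induction N with
  | zero => simp
  | succ N ih =>
    rw [List.replicate_succ, List.cons_append, occ_cons_right, ih, if_neg, zero_add]
    intro h
    have h1 := hv.1
    cases v with
    | nil => simp at h1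
    | cons x v =>
      rw [List.cons_prefix_cons] at h
      simp [h.1] at h1

theorem IsCapped.occ_append_replicate_append {v : Word 2} (hv : IsCapped v) {N : ℕ}
    (hN : v.length ≤ N) (w y : Word 2) :
    occ v (w ++ (List.replicate N a₁ ++ y)) = occ v w + occ v y := by
  induction w with
  | nil => simp [hv.occ_replicate_append, occ_nil_right]
  | cons x w ih =>
    rw [List.cons_append, occ_cons_right, occ_cons_right, ih, ← List.cons_append]
    have : v <+: x :: w ++ (List.replicate N a₁ ++ y) ↔ v <+: x :: w :=
      ⟨hv.prefix_append_replicate hN, fun h => h.trans (List.prefix_append _ _)⟩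
    simp only [this]
    omega

/-- The `n`-th power of the word `w a₁^N`. -/
def paddedPow (w : Word 2) (N : ℕ) : ℕ → Word 2
  | 0 => []
  | n + 1 => w ++ (List.replicate N a₁ ++ paddedPow w N n)

theorem length_paddedPow (w : Word 2) (N n : ℕ) :
    (paddedPow w N n).length = n * (w.length + N) := by
  induction n with
  | zero => simp [paddedPow]
  | succ n ih => simp [paddedPow, ih]; ring

theorem IsCapped.occ_paddedPow {v : Word 2} (hv : IsCapped v) {N : ℕ} (hN : v.length ≤ N)
    (w : Word 2) (n : ℕ) : occ v (paddedPow w N n) = n * occ v w := by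
  induction n with
  | zero => simp [paddedPow, occ_nil_right]
  | succ n ih => rw [paddedPow, hv.occ_append_replicate_append hN, ih]; ring

theorem occ_self {v : Word r} (hv : v ≠ []) : occ v v = 1 := by
  cases v with
  | nil => exact absurd rfl hv
  | cons x v =>
    rw [occ_cons_right, if_pos (List.prefix_refl _)]
    unfold occ
    rw [Finset.card_eq_zero.2]
    rw [Finset.filter_eq_empty_iff]
    intro i _ h
    have := h.length_le
    simp at this
    omega

theorem occ_eq_zero_of_length_le {v w : Word r} (h : w.length ≤ v.length) (hne : v ≠ w) :
    occ v w = 0 := by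
  unfold occ
  rw [Finset.card_eq_zero, Finset.filter_eq_empty_iff]
  intro i hi hp
  have hl := hp.length_le
  rw [List.length_drop] at hl
  rw [Finset.mem_range] at hi
  obtain rfl : i = 0 := by omega
  rw [List.drop_zero] at hp
  exact hne (hp.eq_of_length (by omega))

end Occ

/-! ### Enumeration of the capped words. -/

section Decomposition

theorem isCapped_cons_append (x : Word 2) : IsCapped ([a₂] ++ x ++ [a₂]) := by
  simp [IsCapped, List.getLast?_cons]

theorem IsCapped.eq_singleton_or {v : Word 2} (hv : IsCapped v) :
    v = [a₂] ∨ ∃ x, v = [a₂] ++ x ++ [a₂] := by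
  obtain ⟨h1, h2⟩ := hv
  cases v with
  | nil => simp at h1
  | cons y v =>
    obtain rfl : y = a₂ := by simpa using h1
    rcases v.eq_nil_or_concat' with rfl | ⟨s, x, rfl⟩
    · exact Or.inl rfl
    · rw [← List.cons_append, List.getLast?_append] at h2
      obtain rfl : x = a₂ := by simpa using h2
      exact Or.inr ⟨s, by simp⟩

/-- Applied to the interior of a capped word, this yields the two shapes that match `B_U'` and
`B_V'`. -/
theorem eq_replicate_or_exists_isCapped (x : Word 2) :
    (∃ i, x = List.replicate i a₁) ∨
      ∃ i j v, IsCapped v ∧ x = List.replicate i a₁ ++ v ++ List.replicate j a₁ := by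
  induction x with
  | nil => exact Or.inl ⟨0, rfl⟩
  | cons y x ih =>
    obtain rfl | rfl : y = a₁ ∨ y = a₂ := by fin_cases y <;> simp
    · rcases ih with ⟨i, rfl⟩ | ⟨i, j, v, hv, rfl⟩
      · exact Or.inl ⟨i + 1, by simp [List.replicate_succ]⟩
      · exact Or.inr ⟨i + 1, j, v, hv, by simp [List.replicate_succ]⟩
    · right
      rcases ih with ⟨i, rfl⟩ | ⟨i, j, v, hv, rfl⟩
      · exact ⟨0, i, [a₂], ⟨rfl, rfl⟩, by simp⟩
      · refine ⟨0, j, a₂ :: (List.replicate i a₁ ++ v), ⟨rfl, ?_⟩, by simp⟩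
        rw [← List.cons_append, List.getLast?_append, hv.2]
        rfl

theorem IsCapped.mem {v : Word 2} (hv : IsCapped v) : a₂ ∈ v := List.mem_of_mem_head? hv.1

theorem replicate_append_inj {i i' : ℕ} {y y' : Word 2} (hy : y.head? = some a₂)
    (hy' : y'.head? = some a₂)
    (h : List.replicate i a₁ ++ y = List.replicate i' a₁ ++ y') : i = i' ∧ y = y' := by
  induction i generalizing i' with
  | zero =>
    cases i' with
    | zero => simpa using h
    | succ i' => simp [List.replicate_succ] at h; simp [h] at hy
  | succ i ih =>
    cases i' with
    | zero => simp [List.replicate_succ] at h; simp [← h] at hy'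
    | succ i' =>
      simp only [List.replicate_succ, List.cons_append, List.cons.injEq, true_and] at h
      obtain ⟨rfl, rfl⟩ := ih h
      simp

theorem IsCapped.padded_inj {i i' j j' : ℕ} {v v' : Word 2} (hv : IsCapped v) (hv' : IsCapped v')
    (h : List.replicate i a₁ ++ v ++ List.replicate j a₁ =
      List.replicate i' a₁ ++ v' ++ List.replicate j' a₁) : i = i' ∧ j = j' ∧ v = v' := by
  rw [List.append_assoc, List.append_assoc] at h
  obtain ⟨rfl, htail⟩ := replicate_append_inj (by rw [List.head?_append, hv.1]; rfl)
    (by rw [List.head?_append, hv'.1]; rfl) h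
  have hrev := congrArg List.reverse htail
  simp only [List.reverse_append, List.reverse_replicate] at hrev
  obtain ⟨rfl, hvv⟩ := replicate_append_inj (List.head?_reverse.trans hv.2)
    (List.head?_reverse.trans hv'.2) hrev
  exact ⟨rfl, rfl, List.reverse_injective hvv⟩

/-- The index type of the bases: `ℕ` for the powers of `a₁`, triples `(i, j, v)` for the words
`a₂ a₁^i v a₁^j a₂`. -/
abbrev Idx : Type := ℕ ⊕ (ℕ × ℕ × {v : Word 2 // IsCapped v})

/-- The enumeration of the words that are empty or capped. -/
def word : Idx → Word 2
  | .inl 0 => []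
  | .inl 1 => [a₂]
  | .inl (i + 2) => [a₂] ++ List.replicate i a₁ ++ [a₂]
  | .inr (i, j, v) => [a₂] ++ (List.replicate i a₁ ++ v ++ List.replicate j a₁) ++ [a₂]

theorem word_eq_nil_or_isCapped (p : Idx) : word p = [] ∨ IsCapped (word p) := by
  rcases p with (_ | _ | i) | ⟨i, j, v⟩
  · exact Or.inl rfl
  · exact Or.inr ⟨rfl, rfl⟩
  · exact Or.inr (isCapped_cons_append _)
  · exact Or.inr (isCapped_cons_append _)

theorem IsCapped.exists_word_eq {v : Word 2} (hv : IsCapped v) : ∃ p, word p = v := by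
  rcases hv.eq_singleton_or with rfl | ⟨x, rfl⟩
  · exact ⟨.inl 1, rfl⟩
  · rcases eq_replicate_or_exists_isCapped x with ⟨i, rfl⟩ | ⟨i, j, v, hv', rfl⟩
    · exact ⟨.inl (i + 2), rfl⟩
    · exact ⟨.inr (i, j, ⟨v, hv'⟩), rfl⟩

theorem IsCapped.padded_ne_replicate {v : Word 2} (hv : IsCapped v) (i j k : ℕ) :
    List.replicate i a₁ ++ v ++ List.replicate j a₁ ≠ List.replicate k a₁ := by
  intro h
  have : a₂ ∈ List.replicate k a₁ := by rw [← h]; simp [hv.mem]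
  simpa using List.eq_of_mem_replicate this

theorem word_injective : Function.Injective word := by
  rintro ((_ | _ | i) | ⟨i, j, v, hv⟩) ((_ | _ | i') | ⟨i', j', v', hv'⟩) h <;>
    simp only [word] at h
  all_goals try rfl
  all_goals try (have := congrArg List.length h; simp at this; done)
  · have := congrArg List.length h
    simp at this
    simp [this]
  · rw [List.append_cancel_right_eq, List.append_cancel_left_eq] at h
    exact absurd h.symm (hv'.padded_ne_replicate _ _ _)
  · rw [List.append_cancel_right_eq, List.append_cancel_left_eq] at h
    exact absurd h (hv.padded_ne_replicate _ _ _)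
  · rw [List.append_cancel_right_eq, List.append_cancel_left_eq] at h
    obtain ⟨rfl, rfl, rfl⟩ := hv.padded_inj hv' h
    rfl

end Decomposition

/-! ### The basis of empty and capped words. -/

section Module

variable {R : Type} [NormedCommRing R]

theorem mk_eq_zero_iff_bounded {f : Counting R 2} :
    (Submodule.Quotient.mk f : CHat R 2) = 0 ↔ ∃ K : ℝ, ∀ w, ‖(f : Word 2 → R) w‖ ≤ K := by
  rw [Submodule.Quotient.mk_eq_zero]
  rfl

theorem rhoClass_eq_add_of_occ {u v v' : Word 2} {p q : Word 2 → Prop} [DecidablePred p]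
    [DecidablePred q]
    (h : ∀ w, occ u w + (if p w then 1 else 0) = occ v w + occ v' w + (if q w then 1 else 0)) :
    rhoClass R u = rhoClass R v + rhoClass R v' := by
  rw [← sub_eq_zero]
  -- The difference of two indicators; `‖1‖` need not be `1` in a general normed ring.
  refine mk_eq_zero_iff_bounded.2 ⟨‖(1 : R)‖ + ‖(1 : R)‖, fun w => ?_⟩
  have h2 : (occ u w : R) - (occ v w + occ v' w) =
      (if q w then 1 else 0) - (if p w then 1 else 0) := by
    have := congrArg (Nat.cast (R := R)) (h w)
    push_cast at this
    linear_combination this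
  change ‖(occ u w : R) - (occ v w + occ v' w)‖ ≤ _
  rw [h2]
  refine (norm_sub_le _ _).trans (add_le_add ?_ ?_) <;> split_ifs <;> simp

theorem rhoClass_left_extension (u : Word 2) :
    rhoClass R u = rhoClass R (a₁ :: u) + rhoClass R (a₂ :: u) :=
  rhoClass_eq_add_of_occ (p := fun _ => u = []) (q := fun w => u <+: w) (occ_left_extension u)

theorem rhoClass_right_extension (u : Word 2) :
    rhoClass R u = rhoClass R (u ++ [a₁]) + rhoClass R (u ++ [a₂]) :=
  rhoClass_eq_add_of_occ (p := fun _ => u = []) (q := fun w => u <:+ w) (occ_right_extension u)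

theorem span_range_rhoClass : Submodule.span R (Set.range (rhoClass R (r := 2))) = ⊤ := by
  have h : Submodule.span R
      (Set.range fun v : Word 2 => (⟨rho R v, Submodule.subset_span ⟨v, rfl⟩⟩ : Counting R 2)) =
      ⊤ := by
    refine Eq.trans ?_ (Submodule.span_span_coe_preimage (R := R)
      (s := Set.range fun v : Word 2 => rho R v))
    congr 1
    ext ⟨x, hx⟩
    simp only [Set.mem_range, Subtype.ext_iff]
    rfl
  have h' := congrArg (Submodule.map ((Bounded R 2).submoduleOf (Counting R 2)).mkQ) h
  rw [Submodule.map_span, Submodule.map_top, Submodule.range_mkQ, ← Set.range_comp] at h'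
  exact h'

/-- A final `a₁` is removed by `ρ_{a₂ya₁} = ρ_{a₂y} - ρ_{a₂ya₂}`, where `a₂y` is shorter and `a₂ya₂`
is capped. -/
theorem rhoClass_cons_mem_span_word (n : ℕ) (x : Word 2) (hx : x.length = n) :
    rhoClass R (a₂ :: x) ∈ Submodule.span R (Set.range fun p => rhoClass R (word p)) := by
  have key : ∀ v, IsCapped v →
      rhoClass R v ∈ Submodule.span R (Set.range fun p => rhoClass R (word p)) := by
    intro v hv
    obtain ⟨p, rfl⟩ := hv.exists_word_eq
    exact Submodule.subset_span ⟨p, rfl⟩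
  induction n generalizing x with
  | zero =>
    obtain rfl := List.length_eq_zero_iff.1 hx
    exact key _ ⟨rfl, rfl⟩
  | succ n ih =>
    rcases x.eq_nil_or_concat' with rfl | ⟨y, c, rfl⟩
    · simp at hx
    · obtain rfl | rfl : c = a₁ ∨ c = a₂ := by fin_cases c <;> simp
      · have h := rhoClass_right_extension (R := R) (a₂ :: y)
        rw [← List.cons_append, ← sub_eq_of_eq_add h]
        exact sub_mem (ih y (by simpa using hx)) (key _ (isCapped_cons_append y))
      · exact key _ (isCapped_cons_append y)

theorem span_rhoClass_word :
    Submodule.span R (Set.range fun p => rhoClass R (word p)) = ⊤ := by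
  rw [eq_top_iff, ← span_range_rhoClass, Submodule.span_le]
  rintro _ ⟨u, rfl⟩
  induction u with
  | nil => exact Submodule.subset_span ⟨.inl 0, rfl⟩
  | cons c u ih =>
    obtain rfl | rfl : c = a₁ ∨ c = a₂ := by fin_cases c <;> simp
    · have h := rhoClass_left_extension (R := R) u
      rw [← sub_eq_of_eq_add h]
      exact sub_mem ih (rhoClass_cons_mem_span_word _ u rfl)
    · exact rhoClass_cons_mem_span_word _ u rfl

variable (R) in
/-- Only `0` has bounded integral multiples. -/
def NoBoundedMultiples : Prop := ∀ x : R, (∃ K : ℝ, ∀ n : ℕ, ‖(n : R) * x‖ ≤ K) → x = 0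

theorem noBoundedMultiples_of_norm
    (h : ∀ (n : ℕ) (x : R), ‖(n : R) * x‖ = n * ‖x‖) : NoBoundedMultiples R := by
  rintro x ⟨K, hK⟩
  by_contra hx
  have hpos : 0 < ‖x‖ := norm_pos_iff.2 hx
  obtain ⟨n, hn⟩ := exists_nat_gt (K / ‖x‖)
  rw [div_lt_iff₀ hpos] at hn
  have := hK n
  rw [h] at this
  linarith

theorem linearIndependent_rhoClass_word (hR : NoBoundedMultiples R) :
    LinearIndependent R fun p => rhoClass R (word p) := by
  classical
  rw [linearIndependent_iff']
  intro s c hc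
  have hb : ∃ K : ℝ, ∀ w, ‖∑ p ∈ s, c p * (occ (word p) w : R)‖ ≤ K := by
    have h0 : (Submodule.Quotient.mk (∑ p ∈ s, c p •
        (⟨rho R (word p), Submodule.subset_span ⟨word p, rfl⟩⟩ : Counting R 2)) : CHat R 2) = 0 := by
      rw [← hc, ← Submodule.mkQ_apply, map_sum]
      rfl
    obtain ⟨K, hK⟩ := mk_eq_zero_iff_bounded.1 h0
    refine ⟨K, fun w => ?_⟩
    simpa [rho, Finset.sum_apply] using hK w
  obtain ⟨K, hK⟩ := hb
  set N := s.sup fun p => (word p).length with hN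
  -- `n` times this sum is the bounded combination evaluated at `(w a₁^M)^n`; the empty word
  -- contributes the length.
  have hocc : ∀ M ≥ N, ∀ w, ∑ p ∈ s,
      c p * ((if word p = [] then w.length + M else occ (word p) w : ℕ) : R) = 0 := by
    intro M hM w
    refine hR _ ⟨K, fun n => ?_⟩
    convert hK (paddedPow w M n) using 2
    rw [Finset.mul_sum]
    refine Finset.sum_congr rfl fun p hp => ?_
    rw [mul_left_comm, ← Nat.cast_mul]
    congr 2
    split_ifs with h
    · rw [h, occ_nil, length_paddedPow]
    · have hcap := (word_eq_nil_or_isCapped p).resolve_left h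
      have : (word p).length ≤ N := Finset.le_sup (f := fun p => (word p).length) hp
      rw [hcap.occ_paddedPow (this.trans hM)]
  have hnil : ∀ p ∈ s, word p = [] → c p = 0 := by
    intro p hp hpn
    -- Lengthening the padding by one letter changes only the term of the empty word, by its
    -- coefficient.
    have h1 := hocc N le_rfl []
    have h2 := hocc (N + 1) (by omega) []
    have h3 := congrArg₂ (· - ·) h2 h1
    simp only [← Finset.sum_sub_distrib, sub_zero] at h3
    rw [Finset.sum_eq_single_of_mem p hp] at h3
    · simpa [hpn, ← mul_sub] using h3
    · intro q _ hq
      have : word q ≠ [] := fun h => hq (word_injective (h.trans hpn.symm))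
      simp [this]
  have hind : ∀ n, ∀ p ∈ s, (word p).length = n → c p = 0 := by
    intro n
    induction n using Nat.strong_induction_on with
    | _ n ih =>
      intro p hp hpn
      by_cases h0 : word p = []
      · exact hnil p hp h0
      -- On `word p`, shorter words have coefficient zero by induction and other words at least as
      -- long do not occur.
      have h1 := hocc N le_rfl (word p)
      rw [Finset.sum_eq_single_of_mem p hp] at h1
      · simpa [h0, occ_self h0] using h1
      · intro q hq hqp
        by_cases hq0 : word q = []
        · rw [hnil q hq hq0, zero_mul]
        rcases lt_or_ge (word q).length n with hl | hl
        · rw [ih _ hl q hq rfl, zero_mul]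
        · rw [if_neg hq0, occ_eq_zero_of_length_le (by omega) fun h => hqp (word_injective h)]
          simp
  exact fun p hp => hind _ p hp rfl

/-- The basis of `CHat R 2` consisting of the empty word and the capped words. -/
noncomputable def cappedBasis (hR : NoBoundedMultiples R) : Module.Basis Idx R (CHat R 2) :=
  Module.Basis.mk (linearIndependent_rhoClass_word hR) span_rhoClass_word.ge

theorem cappedBasis_apply (hR : NoBoundedMultiples R) (p : Idx) :
    cappedBasis hR p = rhoClass R (word p) := by
  simp [cappedBasis]

end Module

/-! ### Triangular change of basis. -/

section Triangular

variable {R M ι : Type*} [CommRing R] [AddCommGroup M] [Module R M]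

/-- A family that is triangular with respect to a basis and a degree function, with invertible
diagonal coefficients, is linearly independent and spans. -/
theorem linearIndependent_and_span_of_triangular (b : Module.Basis ι R M) (f : ι → M) (d : ι → ℕ)
    (u : ι → Rˣ)
    (h : ∀ i, f i - u i • b i ∈ Submodule.span R (b '' {j | d j < d i})) :
    LinearIndependent R f ∧ Submodule.span R (Set.range f) = ⊤ := by
  classical
  constructor
  · have hcoord : ∀ i j, d j ≤ d i → j ≠ i → b.repr (f j) i = 0 := by
      intro i j hij hne
      have h1 := (b.mem_span_image.1 (h j))
      have h2 : b.repr (f j - u j • b j) i = 0 := by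
        by_contra hn
        have := h1 (Finsupp.mem_support_iff.2 hn)
        simp only [Set.mem_ofPred_eq] at this
        omega
      simpa [Units.smul_def, Finsupp.single_apply, hne] using h2
    have hdiag : ∀ i, b.repr (f i) i = u i := by
      intro i
      have h1 := (b.mem_span_image.1 (h i))
      have h2 : b.repr (f i - u i • b i) i = 0 := by
        by_contra hn
        have := h1 (Finsupp.mem_support_iff.2 hn)
        simp at this
      simpa [Units.smul_def, sub_eq_zero] using h2
    rw [linearIndependent_iff']
    intro s c hc
    by_contra! hex
    obtain ⟨i₀, hi₀, hci₀⟩ := hex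
    -- At an index of maximal degree with nonzero coefficient, no other term of the relation has a
    -- `b i` coordinate.
    obtain ⟨i, hi, hmax⟩ := (s.filter fun i => c i ≠ 0).exists_max_image d
      ⟨i₀, Finset.mem_filter.2 ⟨hi₀, hci₀⟩⟩
    rw [Finset.mem_filter] at hi
    have h1 := congrArg (fun x => b.repr x i) hc
    simp only [map_sum, map_smul, Finsupp.coe_finsetSum, Finset.sum_apply, map_zero,
      Finsupp.coe_zero, Pi.zero_apply, Finsupp.smul_apply, smul_eq_mul] at h1
    rw [Finset.sum_eq_single_of_mem i hi.1, hdiag] at h1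
    · exact hi.2 ((Units.mul_left_eq_zero _).1 h1)
    · intro j hj hji
      by_cases hcj : c j = 0
      · rw [hcj, zero_mul]
      · rw [hcoord i j (hmax j (Finset.mem_filter.2 ⟨hj, hcj⟩)) hji, mul_zero]
  · have hmem : ∀ n i, d i = n → b i ∈ Submodule.span R (Set.range f) := by
      intro n
      induction n using Nat.strong_induction_on with
      | _ n ih =>
        intro i hi
        have h1 : f i - u i • b i ∈ Submodule.span R (Set.range f) := by
          refine Submodule.span_le.2 ?_ (h i)
          rintro _ ⟨j, hj, rfl⟩
          exact ih (d j) (hi ▸ hj) j rfl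
        have h2 := Submodule.smul_mem _ ((u i)⁻¹ : Rˣ).val
          (sub_mem (Submodule.subset_span (Set.mem_range_self i)) h1)
        rwa [sub_sub_cancel, ← Units.smul_def, inv_smul_smul] at h2
    rw [eq_top_iff, ← b.span_eq, Submodule.span_le]
    rintro _ ⟨i, rfl⟩
    exact hmem _ i rfl

end Triangular

/-! ### Triangularity of `B'`. -/

section Basis

variable {R : Type} [NormedCommRing R]

variable (R) in
/-- The family underlying the set `B'`. -/
noncomputable def blockFamily : Idx → CHat R 2
  | .inl k => rhoClass R (List.replicate k a₁)
  | .inr (i, j, v) => sigmaClass R (i + 1) (j + 1) v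

theorem range_blockFamily : Set.range (blockFamily R) = B' R := by
  ext x
  constructor
  · rintro ⟨k | ⟨i, j, v, hv⟩, rfl⟩
    · exact Or.inr ⟨k, rfl⟩
    · exact Or.inl ⟨i + 1, j + 1, v, by omega, by omega, hv.1, hv.2, rfl⟩
  · rintro (⟨k, m, v, hk, hm, h1, h2, rfl⟩ | ⟨k, rfl⟩)
    · refine ⟨.inr (k - 1, m - 1, ⟨v, h1, h2⟩), ?_⟩
      simp only [blockFamily, Nat.sub_add_cancel hk, Nat.sub_add_cancel hm]
    · exact ⟨.inl k, rfl⟩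

/-- The second difference of `ρ_{a₁^i}`: extending `a₁^i` first on the right and then on the left
isolates `a₂ a₁^i a₂`. -/
theorem rhoClass_replicate_add_two (i : ℕ) :
    rhoClass R (List.replicate (i + 2) a₁) =
      rhoClass R (word (.inl (i + 2))) + (rhoClass R (List.replicate (i + 1) a₁) +
        rhoClass R (List.replicate (i + 1) a₁) - rhoClass R (List.replicate i a₁)) := by
  have h1 := rhoClass_right_extension (R := R) (List.replicate i a₁)
  have h2 := rhoClass_right_extension (R := R) (List.replicate (i + 1) a₁)
  have h3 := rhoClass_left_extension (R := R) (List.replicate i a₁ ++ [a₂])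
  rw [← List.replicate_succ'] at h1 h2
  rw [← List.cons_append, ← List.replicate_succ] at h3
  have hw : word (.inl (i + 2)) = a₂ :: (List.replicate i a₁ ++ [a₂]) := by simp [word]
  rw [hw, h1, h3]
  nth_rewrite 2 [h2]
  abel

/-- The degree with respect to which `blockFamily` is triangular. -/
def degree : Idx → ℕ
  | .inl k => k
  | .inr (i, j, _) => i + j

variable (R) in
/-- The diagonal coefficients of `blockFamily`. -/
def diagCoeff : Idx → Rˣ
  | .inl 1 => -1
  | _ => 1

theorem blockFamily_triangular (p : Idx) :
    blockFamily R p - diagCoeff R p • rhoClass R (word p) ∈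
      Submodule.span R ((fun q => rhoClass R (word q)) '' {q | degree q < degree p}) := by
  rcases p with k | ⟨k, m, v⟩
  · induction k using Nat.strong_induction_on with
    | _ k ih =>
      -- The induction hypothesis omits the diagonal term; it has degree `n < k`, so it can be added
      -- back.
      have hlow : ∀ n < k, rhoClass R (List.replicate n a₁) ∈ Submodule.span R
          ((fun q => rhoClass R (word q)) '' {q | degree q < degree (.inl k)}) := by
        intro n hn
        have h1 := Submodule.span_mono (Set.image_mono fun q (hq : degree q < n) =>
          show degree q < k from hq.trans hn) (ih n hn)
        have h2 : rhoClass R (word (.inl n)) ∈ Submodule.span R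
            ((fun q => rhoClass R (word q)) '' {q | degree q < degree (.inl k)}) :=
          Submodule.subset_span ⟨.inl n, hn, rfl⟩
        have h3 := add_mem h1 (Submodule.smul_mem _ (diagCoeff R (.inl n)).val h2)
        rwa [← Units.smul_def, sub_add_cancel] at h3
      match k, hlow with
      | 0, _ => simp [blockFamily, word, diagCoeff]
      | 1, hlow =>
        -- `ρ_{a₁} = ρ_ε - ρ_{a₂}` is the source of the diagonal coefficient `-1`.
        have h := rhoClass_left_extension (R := R) []
        have : blockFamily R (.inl 1) - diagCoeff R (.inl 1) • rhoClass R (word (.inl 1)) =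
            rhoClass R (List.replicate 0 a₁) := by
          simp [blockFamily, word, diagCoeff, h]
        rw [this]
        exact hlow 0 (by omega)
      | i + 2, hlow =>
        have : blockFamily R (.inl (i + 2)) -
            diagCoeff R (.inl (i + 2)) • rhoClass R (word (.inl (i + 2))) =
            rhoClass R (List.replicate (i + 1) a₁) + rhoClass R (List.replicate (i + 1) a₁) -
              rhoClass R (List.replicate i a₁) := by
          simp only [blockFamily, diagCoeff, one_smul]
          rw [rhoClass_replicate_add_two, add_sub_cancel_left]
        rw [this]
        have h1 := hlow (i + 1) (by omega)
        exact sub_mem (add_mem h1 h1) (hlow i (by omega))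
  · have hs : blockFamily R (.inr (k, m, v)) =
        ∑ x ∈ Finset.range (k + 1) ×ˢ Finset.range (m + 1),
          rhoClass R (word (.inr (x.1, x.2, v))) := by
      simp [blockFamily, sigmaClass, Finset.sum_product, word]
    have hmem : (k, m) ∈ Finset.range (k + 1) ×ˢ Finset.range (m + 1) := by simp
    rw [hs, ← Finset.add_sum_erase _ _ hmem]
    simp only [diagCoeff, one_smul, add_sub_cancel_left]
    refine sum_mem fun x hx => Submodule.subset_span ⟨.inr (x.1, x.2, v), ?_, rfl⟩
    obtain ⟨i, j⟩ := x
    simp only [Finset.mem_erase, ne_eq, Prod.mk.injEq, Finset.mem_product, Finset.mem_range] at hx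
    simp only [degree, Set.mem_ofPred_eq]
    omega

theorem isBasis_B' (hR : NoBoundedMultiples R) : IsBasis R (B' R) := by
  obtain ⟨hli, hsp⟩ := linearIndependent_and_span_of_triangular (cappedBasis hR) (blockFamily R)
    degree (diagCoeff R) fun p => by
      have := blockFamily_triangular (R := R) p
      rwa [← cappedBasis_apply hR, ← funext (cappedBasis_apply hR)] at this
  rw [← range_blockFamily]
  have hb : ⇑(Module.Basis.mk hli hsp.ge) = blockFamily R := Module.Basis.coe_mk _ _
  rw [← hb]
  exact ⟨_, Module.Basis.reindexRange_apply _⟩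

end Basis

end CountingFn

theorem proposition2p7 :
    CountingFn.IsBasis ℤ (CountingFn.B' ℤ) ∧
    CountingFn.IsBasis ℚ (CountingFn.B' ℚ) ∧
    CountingFn.IsBasis ℝ (CountingFn.B' ℝ) ∧
    CountingFn.IsBasis ℂ (CountingFn.B' ℂ) := by
  open CountingFn in
  refine ⟨isBasis_B' (noBoundedMultiples_of_norm fun n x => ?_),
    isBasis_B' (noBoundedMultiples_of_norm fun n x => ?_),
    isBasis_B' (noBoundedMultiples_of_norm fun n x => ?_),
    isBasis_B' (noBoundedMultiples_of_norm fun n x => ?_)⟩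
  · rw [norm_mul, Int.norm_natCast]
  · rw [norm_mul, ← Int.cast_natCast, Int.norm_cast_rat, Int.norm_natCast]
  · rw [norm_mul, Real.norm_natCast]
  · rw [norm_mul, Complex.norm_natCast]
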